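/- Let $\alpha$ be a finite ordinal. A polyadic-type algebra is an algebra $\langle A,+,-,c_i,d_{ij},p_{ij}\rangle_{i,j<\alpha}$ with $+$ binary, $-,c_i,p_{ij}$ unary and $d_{ij}$ nullary. $Pse_\alpha$ is the class of polyadic equality set algebras of dimension $\alpha$, that is, of the algebras $\langle A,\cup,-,C_i^U,D_{ij}^U,P_{ij}\rangle_{i,j<\alpha}$ in which $A$ is, for some set $U$, a family of subsets of $U^\alpha$ closed under union, complementation with respect to $U^\alpha$, the cylindrifications $C_i^U X=\{s\in U^\alpha:\ s_j=s'_j \text{ for all } j\ne i, \text{ for some } s'\in X\}$ and the transpositions $P_{ij}X=\{s\in U^\alpha:\ s_i=s'_j,\ s_j=s'_i \text{ and } s_l=s'_l \text{ for all } l\ne i,j, \text{ for some } s'\in X\}$, and containing the diagonals $D_{ij}^U=\{s\in U^\alpha:\ s_i=s_j\}$. An algebra is $n$-generated if it is generated by a set of at most $n$ of its elements. Theorem. For all $\alpha$ and $n$ with $3\le\alpha<\omega$ and $n<\omega$ there exists a polyadic-type algebra $\mathcal A$ with the following properties. (i) $\mathcal A$ is not isomorphic to a member of $Pse_\alpha$.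 (ii) Each $n$-generated subalgebra of $\mathcal A$ is isomorphic to a member of $Pse_\alpha$. (iii) The cylindrification-free reduct $\langle A,+,-,d_{ij},p_{ij}\rangle_{i,j<\alpha}$, the diagonal-free reduct $\langle A,+,-,c_i,p_{ij}\rangle_{i,j<\alpha}$ and the transposition-free reduct $\langle A,+,-,c_i,d_{ij}\rangle_{i,j<\alpha}$ of $\mathcal A$ are all isomorphic to subalgebras of the corresponding reducts of members of $Pse_\alpha$. -/

import Mathlib

universe u v

open scoped FirstOrder

/-- The operation symbols `+, -, c_i, d_ij, p_ij` (`i, j < α`) of polyadic-type algebras,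
indexed by their arity. -/
inductive PolyadicOp (α : ℕ) : ℕ → Type
  | join : PolyadicOp α 2
  | compl : PolyadicOp α 1
  | cyl (i : Fin α) : PolyadicOp α 1
  | diag (i j : Fin α) : PolyadicOp α 0
  | transp (i j : Fin α) : PolyadicOp α 1

namespace PolyadicOp

/-- The symbol is one of the cylindrifications `c_i`. -/
def IsCyl {α : ℕ} : ∀ {n : ℕ}, PolyadicOp α n → Prop
  | _, .cyl _ => True
  | _, _ => False

/-- The symbol is one of the diagonal constants `d_ij`. -/
def IsDiag {α : ℕ} : ∀ {n : ℕ}, PolyadicOp α n → Prop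
  | _, .diag _ _ => True
  | _, _ => False

/-- The symbol is one of the transposition operations `p_ij`. -/
def IsTransp {α : ℕ} : ∀ {n : ℕ}, PolyadicOp α n → Prop
  | _, .transp _ _ => True
  | _, _ => False

end PolyadicOp

/-- The algebraic similarity type of `α`-dimensional polyadic equality set algebras. A
polyadic-type algebra is a structure for this language. -/
def polyadicLanguage (α : ℕ) : FirstOrder.Language.{0, 0} :=
  ⟨PolyadicOp α, fun _ => Empty⟩

/-- The part of the polyadic similarity type that consists of the operation symbols in `K`. -/
def polyadicSublanguage (α : ℕ) (K : ∀ n, Set (PolyadicOp α n)) : FirstOrder.Language.{0, 0} :=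
  ⟨fun n => K n, fun _ => Empty⟩

/-- The inclusion of a part of the polyadic similarity type. -/
def polyadicSublanguageHom (α : ℕ) (K : ∀ n, Set (PolyadicOp α n)) :
    polyadicSublanguage α K →ᴸ polyadicLanguage α where
  onFunction _ f := f.1
  onRelation _ r := r

/-- The reduct of a polyadic-type algebra to the operations in `K`. -/
instance polyadicReduct (α : ℕ) (K : ∀ n, Set (PolyadicOp α n)) (A : Type u)
    [(polyadicLanguage α).Structure A] : (polyadicSublanguage α K).Structure A :=
  (polyadicSublanguageHom α K).reduct A

/-- The operations that remain in the cylindrification-free reduct. -/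
def cylFreeOps (α : ℕ) (n : ℕ) : Set (PolyadicOp α n) := {f | ¬ f.IsCyl}

/-- The operations that remain in the diagonal-free reduct. -/
def diagFreeOps (α : ℕ) (n : ℕ) : Set (PolyadicOp α n) := {f | ¬ f.IsDiag}

/-- The operations that remain in the transposition-free (cylindric) reduct. -/
def transpFreeOps (α : ℕ) (n : ℕ) : Set (PolyadicOp α n) := {f | ¬ f.IsTransp}

/-- Cylindrification `C_i^U X`: all `u` that agree with some `u' ∈ X` at all `j ≠ i`. -/
def setCyl {α : ℕ} {U : Type v} (i : Fin α) (X : Set (Fin α → U)) : Set (Fin α → U) :=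
  {s | ∃ s' ∈ X, ∀ j, j ≠ i → s j = s' j}

/-- Diagonal constant `D_ij^U`. -/
def setDiag {α : ℕ} (U : Type v) (i j : Fin α) : Set (Fin α → U) :=
  {s | s i = s j}

/-- Transposition `P_ij X`: all `u` obtained from some `u' ∈ X` by interchanging the
`i`-th and the `j`-th coordinates. -/
def setTransp {α : ℕ} {U : Type v} (i j : Fin α) (X : Set (Fin α → U)) : Set (Fin α → U) :=
  {s | ∃ s' ∈ X, s i = s' j ∧ s j = s' i ∧ ∀ l, l ≠ i → l ≠ j → s l = s' l}

/-- The polyadic equality set algebra of all subsets of `U^α`. -/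
instance fullSetAlgebra (α : ℕ) (U : Type v) :
    (polyadicLanguage α).Structure (Set (Fin α → U)) where
  funMap {n} (f : PolyadicOp α n) :=
    match n, f with
    | _, .join => fun x => x 0 ∪ x 1
    | _, .compl => fun x => (x 0)ᶜ
    | _, .cyl i => fun x => setCyl i (x 0)
    | _, .diag i j => fun _ => setDiag U i j
    | _, .transp i j => fun x => setTransp i j (x 0)
  RelMap r := Empty.elim r

/-- A member of `Pse_α` with base set `U`: a family of subsets of `U^α` that is closed under
all the operations (and contains the diagonals), with the restricted operations. -/
abbrev PolyadicSetAlgebra (α : ℕ) (U : Type v) : Type v :=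
  (polyadicLanguage α).Substructure (Set (Fin α → U))

/-- The polyadic-type algebra `A` is isomorphic to a member of `Pse_α` (with base set in the
universe `v`). -/
def IsoToPse (α : ℕ) (A : Type u) [(polyadicLanguage α).Structure A] : Prop :=
  ∃ (U : Type v) (S : PolyadicSetAlgebra α U), Nonempty (A ≃[polyadicLanguage α] S)

/-- The reduct of `A` to the operations in `K` is isomorphic to a subalgebra of the
corresponding reduct of a member of `Pse_α` (with base set in the universe `v`). -/
def ReductIsoToSubPse (α : ℕ) (K : ∀ n, Set (PolyadicOp α n)) (A : Type u)
    [(polyadicLanguage α).Structure A] : Prop :=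
  ∃ (U : Type v) (S : PolyadicSetAlgebra α U) (T : (polyadicSublanguage α K).Substructure S),
    Nonempty (A ≃[polyadicSublanguage α K] T)

/-- The subalgebra `S` is generated by a set of at most `n` of its elements. -/
def IsNGenerated {α : ℕ} (n : ℕ) {A : Type u} [(polyadicLanguage α).Structure A]
    (S : (polyadicLanguage α).Substructure A) : Prop :=
  ∃ X : Set A, X.encard ≤ n ∧ FirstOrder.Language.Substructure.closure (polyadicLanguage α) X = S

/-! The obstruction is that the complete graph on an odd number `2k+1` of vertices has no
one-factorization. The algebra consists of relations over `Pt k` invariant under all permutations of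
vertices and of tail points. The edges at two given positions then form a single orbit, closed under
interchanging these positions. Each such orbit is split into `2k` abstract parts that no
cylindrification can tell apart.

In a representation, freezing the other coordinates turns the parts into disjoint symmetric edge
colours, each present at every vertex. A labelling gives distinct vertices distinct labels, so there
are at most `2k+1` vertices, and each colour becomes a fixed-point-free involution of an odd set
(`not_injective_hom`, `not_symmetric_split`).

Conversely, `represent` turns a concrete colouring into a representation. Since `3 ≤ α`, every edge
sequence has a tail point, whose colour can be varied freely; this already gives injectivity
(`represent_injOn`). Transpositions need a symmetric edge colouring (`represent_transp`), and
cylindrifications need every colour at every vertex (`represent_cyl`). Arc length on `ZMod (2k+1)`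
satisfies both with `k` colours, two edges of each at every vertex. The missing factor 2 comes from
doubled points when diagonals are dropped and from arc direction when transpositions are dropped;
without cylindrifications a constant edge colouring suffices. An `n`-generated subalgebra
distinguishes at most `2^(α²n)` colours, so for `k` that large arc length alone represents it. -/

open FirstOrder

/-! ### Pointwise form of the set operations. -/

section SetOperations

variable {α : ℕ} {U : Type u}

theorem mem_setCyl {i : Fin α} {X : Set (Fin α → U)} {s : Fin α → U} :
    s ∈ setCyl i X ↔ ∃ a, Function.update s i a ∈ X := by
  constructor
  · rintro ⟨s', hs', h⟩
    refine ⟨s' i, ?_⟩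
    convert hs'
    funext j
    by_cases hj : j = i
    · subst hj; simp
    · simp [hj, h j hj]
  · rintro ⟨a, ha⟩
    exact ⟨_, ha, fun j hj => by simp [hj]⟩

theorem mem_setTransp {i j : Fin α} {X : Set (Fin α → U)} {s : Fin α → U} :
    s ∈ setTransp i j X ↔ s ∘ Equiv.swap i j ∈ X := by
  constructor
  · rintro ⟨s', hs', hi, hj, h⟩
    convert hs'
    funext l
    by_cases hli : l = i
    · subst hli; simp [hj]
    by_cases hlj : l = j
    · subst hlj; simp [hi]
    · simp [Equiv.swap_apply_of_ne_of_ne hli hlj, h l hli hlj]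
  · intro hs
    refine ⟨_, hs, by simp, by simp, fun l hli hlj => ?_⟩
    simp [Equiv.swap_apply_of_ne_of_ne hli hlj]

end SetOperations

/-! ### Colour-indexed relations and their invariant subalgebras. -/

section ColouredSets

/-- Families of subsets of `U^α` that are indexed by colours. -/
def ColouredSets (α : ℕ) (U : Type u) (C : Type) : Type u := C → Set (Fin α → U)

namespace ColouredSets

variable {α : ℕ} {U : Type u} {C : Type}

/-- The operations are taken colourwise, except that cylindrifications forget the colour. -/
instance polyadicStructure : (polyadicLanguage α).Structure (ColouredSets α U C) where
  funMap {n} (f : PolyadicOp α n) :=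
    match n, f with
    | _, .join => fun x c => x 0 c ∪ x 1 c
    | _, .compl => fun x c => (x 0 c)ᶜ
    | _, .cyl i => fun x _ => setCyl i (⋃ c, x 0 c)
    | _, .diag i j => fun _ _ => setDiag U i j
    | _, .transp i j => fun x c => setTransp i j (x 0 c)
  RelMap r := Empty.elim r

open FirstOrder.Language.Structure in
theorem mem_funMap_cyl {i : Fin α} {x : Fin 1 → ColouredSets α U C} {c : C} {s : Fin α → U} :
    s ∈ (funMap (L := polyadicLanguage α) (PolyadicOp.cyl i) x : ColouredSets α U C) c ↔
      ∃ a d, Function.update s i a ∈ x 0 d :=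
  (mem_setCyl (X := ⋃ d, x 0 d)).trans (exists_congr fun _ => Set.mem_iUnion)

open FirstOrder.Language.Structure in
theorem mem_funMap_transp {i j : Fin α} {x : Fin 1 → ColouredSets α U C} {c : C}
    {s : Fin α → U} :
    s ∈ (funMap (L := polyadicLanguage α) (PolyadicOp.transp i j) x : ColouredSets α U C) c ↔
      s ∘ Equiv.swap i j ∈ x 0 c :=
  mem_setTransp (X := x 0 c)

/-- The colour families that are invariant under `G` and depend on the colour only on `Q`. -/
def invariantAlgebra (G : Type) [Group G] [MulAction G U] (Q : Set (Fin α → U))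
    (hQ : ∀ (i j : Fin α) (s : Fin α → U), s ∘ Equiv.swap i j ∈ Q → s ∈ Q) :
    (polyadicLanguage α).Substructure (ColouredSets α U C) where
  carrier := {X | (∀ c (g : G) s, s ∈ X c → g • s ∈ X c) ∧ ∀ s ∉ Q, ∀ c c', s ∈ X c → s ∈ X c'}
  fun_mem {n} f x hx := by
    match n, f with
    | _, .join =>
      refine ⟨fun c g s hs => ?_, fun s hsQ c c' hs => ?_⟩
      · exact hs.imp ((hx 0).1 c g s) ((hx 1).1 c g s)
      · exact hs.imp ((hx 0).2 s hsQ c c') ((hx 1).2 s hsQ c c')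
    | _, .compl =>
      refine ⟨fun c g s hs h => hs ?_, fun s hsQ c c' hs h => hs ?_⟩
      · simpa using (hx 0).1 c g⁻¹ _ h
      · exact (hx 0).2 s hsQ c' c h
    | _, .cyl i =>
      refine ⟨fun c g s hs => ?_, fun s hsQ c c' hs => hs⟩
      obtain ⟨s', hs', h⟩ := hs
      obtain ⟨d, hd⟩ := Set.mem_iUnion.1 hs'
      exact ⟨g • s', Set.mem_iUnion.2 ⟨d, (hx 0).1 d g s' hd⟩, fun j hj => by simp [h j hj]⟩
    | _, .diag i j =>
      refine ⟨fun c g s hs => ?_, fun s hsQ c c' hs => hs⟩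
      exact congrArg (g • ·) hs
    | _, .transp i j =>
      refine ⟨fun c g s hs => ?_, fun s hsQ c c' hs => ?_⟩
      · exact mem_setTransp.2 ((hx 0).1 c g _ (mem_setTransp.1 hs))
      · exact mem_setTransp.2 ((hx 0).2 _ (fun h => hsQ (hQ i j s h)) c c' (mem_setTransp.1 hs))

/-- The set that a colour family describes under a colouring `κ` of the sequences over a base `W`
lying over `U`. -/
def realize {W : Type v} (h : W → U) (κ : (Fin α → W) → C) (X : ColouredSets α U C) :
    Set (Fin α → W) :=
  {w | h ∘ w ∈ X (κ w)}

end ColouredSets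

end ColouredSets

/-! ### Representability from injective operation-preserving maps. -/

section Embeddings

open FirstOrder.Language

variable {α : ℕ}

theorem isoToPse_of_embedding {A : Type u} [(polyadicLanguage α).Structure A] {W : Type v}
    (φ : A → Set (Fin α → W)) (hφ : Function.Injective φ)
    (hfun : ∀ {n} (f : PolyadicOp α n) (x : Fin n → A),
      φ (Structure.funMap (L := polyadicLanguage α) f x) =
        Structure.funMap (L := polyadicLanguage α) f (φ ∘ x)) :
    IsoToPse.{u, v} α A := by
  let e : A ↪[polyadicLanguage α] Set (Fin α → W) :=
    { toFun := φ, inj' := hφ, map_fun' := hfun, map_rel' := fun r => Empty.elim r }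
  exact ⟨W, e.toHom.range, ⟨e.equivRange⟩⟩

theorem reductIsoToSubPse_of_embedding {A : Type u} [(polyadicLanguage α).Structure A]
    {K : ∀ n, Set (PolyadicOp α n)} {W : Type v}
    (φ : A → Set (Fin α → W)) (hφ : Function.Injective φ)
    (hfun : ∀ {n} (f : PolyadicOp α n), f ∈ K n → ∀ (x : Fin n → A),
      φ (Structure.funMap (L := polyadicLanguage α) f x) =
        Structure.funMap (L := polyadicLanguage α) f (φ ∘ x)) :
    ReductIsoToSubPse.{u, v} α K A := by
  let e : A ↪[polyadicSublanguage α K] (⊤ : PolyadicSetAlgebra α W) :=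
    { toFun := fun a => ⟨φ a, trivial⟩
      inj' := fun a b hab => hφ (congrArg Subtype.val hab)
      map_fun' := fun f x => Subtype.ext (hfun f.1 f.2 x)
      map_rel' := fun r => Empty.elim r }
  exact ⟨W, ⊤, e.toHom.range, ⟨e.equivRange⟩⟩

end Embeddings

/-! ### The base set and its symmetries. -/

/-- The `2k` colours. -/
abbrev Colour (k : ℕ) : Type := ZMod k × ZMod 2

/-- The base set: an odd number of vertices, the bijective labellings of the vertices, and
infinitely many further points of each colour. -/
inductive Pt (k : ℕ) : Type u
  | vertex (a : ZMod (2 * k + 1))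
  | labelling (t : Equiv.Perm (ZMod (2 * k + 1)))
  | tail (v : ℕ × Colour k)

namespace Pt

variable {k : ℕ}

/-- Permutations of the vertices and of the tail points. -/
abbrev Sym (k : ℕ) : Type := Equiv.Perm (ZMod (2 * k + 1)) × Equiv.Perm (ℕ × Colour k)

instance : MulAction (Sym k) (Pt.{u} k) where
  smul g
    | vertex a => vertex (g.1 a)
    | labelling t => labelling (g.1 * t)
    | tail v => tail (g.2 v)
  one_smul x := by cases x <;> rfl
  mul_smul g h x := by cases x <;> rfl

@[simp] theorem smul_vertex (g : Sym k) (a) : g • (vertex a : Pt.{u} k) = vertex (g.1 a) := rfl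

@[simp] theorem smul_labelling (g : Sym k) (t) :
    g • (labelling t : Pt.{u} k) = labelling (g.1 * t) := rfl

@[simp] theorem smul_tail (g : Sym k) (v) : g • (tail v : Pt.{u} k) = tail (g.2 v) := rfl

/-- The base sets in different universes are equivalent. -/
def liftEquiv : Pt.{v} k ≃ Pt.{u} k where
  toFun
    | vertex a => vertex a
    | labelling t => labelling t
    | tail v => tail v
  invFun
    | vertex a => vertex a
    | labelling t => labelling t
    | tail v => tail v
  left_inv x := by cases x <;> rfl
  right_inv x := by cases x <;> rfl

end Pt

/-! ### Edge sequences and their orbits. -/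

section EdgeAt

variable {α k : ℕ}

/-- The sequence `s` is injective, has vertices at the positions `p` and `q`, and tail points
elsewhere. -/
def EdgeAt (p q : Fin α) (s : Fin α → Pt.{u} k) : Prop :=
  p ≠ q ∧ Function.Injective s ∧ (∃ a, s p = .vertex a) ∧ (∃ b, s q = .vertex b) ∧
    ∀ j, j ≠ p → j ≠ q → ∃ v, s j = .tail v

/-- The sequences that are edges at some pair of positions. -/
def edgeSet (α k : ℕ) : Set (Fin α → Pt.{u} k) := {s | ∃ p q, EdgeAt p q s}

theorem EdgeAt.symm {p q : Fin α} {s : Fin α → Pt.{u} k} (h : EdgeAt p q s) : EdgeAt q p s :=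
  ⟨h.1.symm, h.2.1, h.2.2.2.1, h.2.2.1, fun j hp hq => h.2.2.2.2 j hq hp⟩

theorem EdgeAt.comp_perm {p q : Fin α} {s : Fin α → Pt.{u} k} (h : EdgeAt p q s)
    (σ : Equiv.Perm (Fin α)) : EdgeAt (σ.symm p) (σ.symm q) (s ∘ σ) := by
  refine ⟨fun e => h.1 (σ.symm.injective e), h.2.1.comp σ.injective, by simpa using h.2.2.1,
    by simpa using h.2.2.2.1, fun j hp hq => h.2.2.2.2 _ ?_ ?_⟩
  · rintro rfl; simp at hp
  · rintro rfl; simp at hq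

theorem mem_edgeSet_of_comp_swap (i j : Fin α) (s : Fin α → Pt.{u} k)
    (h : s ∘ Equiv.swap i j ∈ edgeSet α k) : s ∈ edgeSet α k := by
  obtain ⟨p, q, h⟩ := h
  have hs : (s ∘ Equiv.swap i j) ∘ Equiv.swap i j = s := by
    funext l
    simp
  exact ⟨_, _, hs ▸ h.comp_perm (Equiv.swap i j)⟩

/-- Edges at the same positions lie in the same orbit. -/
theorem EdgeAt.exists_smul_eq {p q : Fin α} {s s' : Fin α → Pt.{u} k} (h : EdgeAt p q s)
    (h' : EdgeAt p q s') : ∃ g : Pt.Sym k, g • s = s' := by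
  obtain ⟨hpq, hs, ⟨a, ha⟩, ⟨b, hb⟩, ht⟩ := h
  obtain ⟨-, hs', ⟨a', ha'⟩, ⟨b', hb'⟩, ht'⟩ := h'
  have hab : a ≠ b := fun e => hpq (hs (by rw [ha, hb, e]))
  have hab' : a' ≠ b' := fun e => hpq (hs' (by rw [ha', hb', e]))
  obtain ⟨σ, hσ⟩ := Equiv.Perm.exists_extending_pair ![a, b] ![a', b']
    (by intro i j; fin_cases i <;> fin_cases j <;> simp [hab, hab.symm])
    (by intro i j; fin_cases i <;> fin_cases j <;> simp [hab', hab'.symm])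
  choose f hf using fun j : {j // j ≠ p ∧ j ≠ q} => ht j.1 j.2.1 j.2.2
  choose f' hf' using fun j : {j // j ≠ p ∧ j ≠ q} => ht' j.1 j.2.1 j.2.2
  obtain ⟨τ, hτ⟩ := Equiv.Perm.exists_extending_pair f f'
    (fun i j e => Subtype.ext (hs (by rw [hf, hf, e])))
    (fun i j e => Subtype.ext (hs' (by rw [hf', hf', e])))
  refine ⟨(σ, τ), ?_⟩
  funext j
  by_cases hjp : j = p
  · subst hjp
    have := hσ 0
    simp_all
  by_cases hjq : j = q
  · subst hjq
    have := hσ 1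
    simp_all
  · have := hτ ⟨j, hjp, hjq⟩
    have h1 := hf ⟨j, hjp, hjq⟩
    have h2 := hf' ⟨j, hjp, hjq⟩
    simp only at h1 h2
    simp [h1, h2, this]

end EdgeAt

/-! ### Colourings of sequences. -/

section Colouring

variable {α k : ℕ} {B Γ : Type} [AddCommGroup Γ]

/-- The colour contributed by a single point. -/
def tailColour (tc : ℕ × Colour k → Γ) : Pt.{u} k → Γ
  | .tail v => tc v
  | _ => 0

/-- The colour contributed by a pair of points. -/
def pairColour (ec : ZMod (2 * k + 1) × B → ZMod (2 * k + 1) × B → Γ) :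
    Pt.{u} k × B → Pt.{u} k × B → Γ
  | (.vertex a, x), (.vertex b, y) => ec (a, x) (b, y)
  | _, _ => 0

/-- The colour of a sequence: that of its edges plus those of its tail points. -/
def colouring (ec : ZMod (2 * k + 1) × B → ZMod (2 * k + 1) × B → Γ) (tc : ℕ × Colour k → Γ)
    (w : Fin α → Pt.{u} k × B) : Γ :=
  (∑ i, ∑ j, if i < j then pairColour ec (w i) (w j) else 0) + ∑ i, tailColour tc (w i).1

theorem pairColour_tail_left {ec : ZMod (2 * k + 1) × B → ZMod (2 * k + 1) × B → Γ}
    {x y : Pt.{u} k × B} {v} (hx : x.1 = .tail v) : pairColour ec x y = 0 := by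
  obtain ⟨x, b⟩ := x
  subst hx
  rfl

theorem pairColour_tail_right {ec : ZMod (2 * k + 1) × B → ZMod (2 * k + 1) × B → Γ}
    {x y : Pt.{u} k × B} {v} (hy : y.1 = .tail v) : pairColour ec x y = 0 := by
  obtain ⟨y, b⟩ := y
  subst hy
  obtain ⟨_ | _ | _, _⟩ := x <;> rfl

/-- Every other pair of positions contains a tail point and contributes 0. The order of `p` and `q`
matters because `ec` need not be symmetric. -/
theorem EdgeAt.colouring_eq {ec : ZMod (2 * k + 1) × B → ZMod (2 * k + 1) × B → Γ}
    {tc : ℕ × Colour k → Γ} {p q : Fin α} {w : Fin α → Pt.{u} k × B}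
    (h : EdgeAt p q fun i => (w i).1) (hpq : p < q) :
    colouring ec tc w = pairColour ec (w p) (w q) + ∑ i, tailColour tc (w i).1 := by
  have ht := h.2.2.2.2
  unfold colouring
  congr 1
  rw [Finset.sum_eq_single p, Finset.sum_eq_single q]
  · simp [hpq]
  · intro j _ hjq
    split_ifs with hlt
    · obtain ⟨v, hv⟩ := ht j hlt.ne' hjq
      exact pairColour_tail_right hv
    · rfl
  · simp
  · intro i _ hip
    refine Finset.sum_eq_zero fun j _ => ?_
    split_ifs with hlt
    · by_cases hiq : i = q
      · subst hiq
        obtain ⟨v, hv⟩ := ht j (hpq.trans hlt).ne' hlt.ne'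
        exact pairColour_tail_right hv
      · obtain ⟨v, hv⟩ := ht i hip hiq
        exact pairColour_tail_left hv
    · rfl
  · simp

/-- A symmetric edge colouring gives a symmetric colouring of sequences. -/
theorem colouring_comp_swap {ec : ZMod (2 * k + 1) × B → ZMod (2 * k + 1) × B → Γ}
    {tc : ℕ × Colour k → Γ} (hec : ∀ x y, ec x y = ec y x) {w : Fin α → Pt.{u} k × B}
    (h : (fun i => (w i).1) ∈ edgeSet α k) (i j : Fin α) :
    colouring ec tc (w ∘ Equiv.swap i j) = colouring ec tc w := by
  have hpc : ∀ x y : Pt.{u} k × B, pairColour ec x y = pairColour ec y x := by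
    rintro ⟨_ | _ | _, _⟩ ⟨_ | _ | _, _⟩ <;> simp [pairColour, hec]
  have key : ∀ {p q : Fin α} {w : Fin α → Pt.{u} k × B}, EdgeAt p q (fun i => (w i).1) →
      colouring ec tc w = pairColour ec (w p) (w q) + ∑ i, tailColour tc (w i).1 := by
    intro p q w h
    rcases lt_or_gt_of_ne h.1 with hlt | hlt
    · exact h.colouring_eq hlt
    · rw [h.symm.colouring_eq hlt, hpc]
  obtain ⟨p, q, h⟩ := h
  have h' : EdgeAt _ _ fun l => ((w ∘ Equiv.swap i j) l).1 := h.comp_perm (Equiv.swap i j)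
  rw [key h', key h]
  congr 1
  · simp
  · exact Equiv.sum_comp (Equiv.swap i j) fun l => tailColour tc (w l).1

/-- Every colour occurs after a suitable change of a given tail point. -/
theorem EdgeAt.recolour_tail {ec : ZMod (2 * k + 1) × B → ZMod (2 * k + 1) × B → Γ}
    {tc : ℕ × Colour k → Γ} (htc : ∀ γ, {v | tc v = γ}.Infinite)
    {p q : Fin α} {w : Fin α → Pt.{u} k × B} (h : EdgeAt p q fun i => (w i).1) {i : Fin α}
    (hip : i ≠ p) (hiq : i ≠ q) (γ : Γ) :
    ∃ y, EdgeAt p q (fun j => (Function.update w i y j).1) ∧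
      colouring ec tc (Function.update w i y) = γ := by
  wlog hpq : p < q generalizing p q
  · obtain ⟨y, hy, hy'⟩ := this h.symm hiq hip (lt_of_le_of_ne (not_lt.1 hpq) h.1.symm)
    exact ⟨y, hy.symm, hy'⟩
  classical
  set c : Γ := pairColour ec (w p) (w q) + ∑ j ∈ Finset.univ \ {i}, tailColour tc (w j).1 with hc
  have hfin : {v : ℕ × Colour k | ∃ j, (w j).1 = .tail v}.Finite := by
    refine (Set.finite_iUnion (f := fun j : Fin α => {v : ℕ × Colour k | (w j).1 = .tail v})
      fun j => Set.Subsingleton.finite ?_).subset ?_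
    · intro v hv v' hv'
      simpa using (hv.symm.trans hv' : (Pt.tail v : Pt.{u} k) = .tail v')
    · rintro v ⟨j, hj⟩
      exact Set.mem_iUnion.2 ⟨j, hj⟩
  -- The new tail point supplies the colour `γ - c` still missing; avoiding the finitely many tail
  -- points in use keeps the sequence injective.
  obtain ⟨v, hv, hvn⟩ := ((htc (γ - c)).sdiff hfin).nonempty
  have hedge : EdgeAt p q (fun j => (Function.update w i (Pt.tail v, (w i).2) j).1) := by
    obtain ⟨-, hs, hp, hq, ht⟩ := h
    have hne : ∀ l, (w l).1 ≠ .tail v := fun l hl => hvn ⟨l, hl⟩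
    refine ⟨hpq.ne, fun j l hjl => ?_, by simpa [hip.symm] using hp,
      by simpa [hiq.symm] using hq, fun j hjp hjq => ?_⟩
    · by_cases hj : j = i <;> by_cases hl : l = i
      · rw [hj, hl]
      · subst hj; simp [hl] at hjl; exact absurd hjl.symm (hne l)
      · subst hl; simp [hj] at hjl; exact absurd hjl (hne j)
      · simp only [Function.update_of_ne hj, Function.update_of_ne hl] at hjl
        exact hs hjl
    · by_cases hj : j = i
      · subst hj; exact ⟨v, by simp⟩
      · simpa [hj] using ht j hjp hjq
  refine ⟨_, hedge, ?_⟩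
  rw [hedge.colouring_eq hpq, Function.update_of_ne hip.symm, Function.update_of_ne hiq.symm]
  have : ∑ j, tailColour tc (Function.update w i (Pt.tail v, (w i).2) j).1 =
      tc v + ∑ j ∈ Finset.univ \ {i}, tailColour tc (w j).1 := by
    rw [← Finset.sum_sdiff (Finset.subset_univ {i}), add_comm]
    congr 1
    · simp [tailColour]
    · refine Finset.sum_congr rfl fun j hj => ?_
      rw [Function.update_of_ne (by simpa using hj)]
  rw [this, show tc v = γ - c from hv, hc]
  abel

/-- If the edge colouring is onto at each vertex, then every colour occurs after a suitable change
of any given point of an edge. -/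
theorem EdgeAt.recolour {ec : ZMod (2 * k + 1) × B → ZMod (2 * k + 1) × B → Γ}
    {tc : ℕ × Colour k → Γ} (htc : ∀ γ, {v | tc v = γ}.Infinite)
    (hleft : ∀ x γ, ∃ y : ZMod (2 * k + 1) × B, y.1 ≠ x.1 ∧ ec x y = γ)
    (hright : ∀ y γ, ∃ x : ZMod (2 * k + 1) × B, x.1 ≠ y.1 ∧ ec x y = γ)
    {p q : Fin α} {w : Fin α → Pt.{u} k × B} (h : EdgeAt p q fun i => (w i).1) (i : Fin α)
    (γ : Γ) :
    ∃ y, EdgeAt p q (fun j => (Function.update w i y j).1) ∧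
      colouring ec tc (Function.update w i y) = γ := by
  have hvertex : ∀ {p q : Fin α}, EdgeAt p q (fun i => (w i).1) → ∀ (a b : ZMod (2 * k + 1)) x,
      (w q).1 = .vertex b → a ≠ b →
      EdgeAt p q (fun j => (Function.update w p (Pt.vertex a, x) j).1) ∧
      ∑ j, tailColour tc (Function.update w p (Pt.vertex a, x) j).1 =
        ∑ j, tailColour tc (w j).1 := by
    intro p q h a b x hb hab
    obtain ⟨hpq, hs, ⟨a', ha'⟩, hq, ht⟩ := h
    have hne : ∀ l, l ≠ p → (w l).1 ≠ .vertex a := by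
      intro l hl e
      by_cases hlq : l = q
      · subst hlq
        rw [hb] at e
        exact hab (Pt.vertex.inj e).symm
      · obtain ⟨v, hv⟩ := ht l hl hlq
        simp only [e] at hv
        exact Pt.noConfusion rfl (heq_of_eq hv)
    refine ⟨⟨hpq, fun j l hjl => ?_, ⟨a, by simp⟩, by simpa [hpq.symm] using hq,
      fun j hjp hjq => by simpa [hjp] using ht j hjp hjq⟩, ?_⟩
    · by_cases hj : j = p <;> by_cases hl : l = p
      · rw [hj, hl]
      · subst hj; simp [hl] at hjl; exact absurd hjl.symm (hne l hl)
      · subst hl; simp [hj] at hjl; exact absurd hjl (hne j hj)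
      · simp only [Function.update_of_ne hj, Function.update_of_ne hl] at hjl
        exact hs hjl
    · refine Finset.sum_congr rfl fun j _ => ?_
      by_cases hj : j = p
      · subst hj
        simp only at ha'
        simp [ha', tailColour]
      · simp [hj]
  wlog hpq : p < q generalizing p q
  · obtain ⟨y, hy, hy'⟩ := this h.symm (lt_of_le_of_ne (not_lt.1 hpq) h.1.symm)
    exact ⟨y, hy.symm, hy'⟩
  obtain ⟨a, ha⟩ := h.2.2.1
  obtain ⟨b, hb⟩ := h.2.2.2.1
  simp only at ha hb
  have hpc : ∀ {x y : Pt.{u} k × B} {a b}, x.1 = .vertex a → y.1 = .vertex b →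
      pairColour ec x y = ec (a, x.2) (b, y.2) := by
    rintro ⟨_, _⟩ ⟨_, _⟩ a b rfl rfl
    rfl
  set S := ∑ j, tailColour tc (w j).1
  by_cases hip : i = p
  · subst hip
    -- Moving a vertex leaves the tail sum `S` unchanged, so the edge itself must contribute `γ -
    -- S`.
    obtain ⟨⟨c, x⟩, hne, hc⟩ := hright (b, (w q).2) (γ - S)
    obtain ⟨h1, h2⟩ := hvertex h c b x hb hne
    refine ⟨_, h1, ?_⟩
    rw [h1.colouring_eq hpq, h2, hpc (a := c) (b := b) (by simp) (by simp [hpq.ne', hb])]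
    simp [hpq.ne', hc, S]
  by_cases hiq : i = q
  · subst hiq
    obtain ⟨⟨c, x⟩, hne, hc⟩ := hleft (a, (w p).2) (γ - S)
    obtain ⟨h1, h2⟩ := hvertex h.symm c a x ha hne
    refine ⟨_, h1.symm, ?_⟩
    rw [h1.symm.colouring_eq hpq, h2, hpc (a := a) (b := c) (by simp [hpq.ne, ha]) (by simp)]
    simp [hpq.ne, hc, S]
  · exact h.recolour_tail htc hip hiq γ

end Colouring

/-! ### The split algebra and its representation maps. -/

section SplitAlgebra

/-- The algebra of the invariant relations over `Pt k` in which the edges are split into `2k`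
symmetric parts. -/
def splitAlgebra (α k : ℕ) : (polyadicLanguage α).Substructure
    (ColouredSets α (Pt.{u} k) (Colour k)) :=
  ColouredSets.invariantAlgebra (Pt.Sym k) (edgeSet α k) mem_edgeSet_of_comp_swap

variable {α k : ℕ}

theorem splitAlgebra_mem_of_edgeAt {X : ColouredSets α (Pt.{u} k) (Colour k)}
    (hX : X ∈ splitAlgebra α k) {p q : Fin α} {s s' : Fin α → Pt.{u} k} (h : EdgeAt p q s)
    (h' : EdgeAt p q s') {c : Colour k} (hs : s ∈ X c) : s' ∈ X c := by
  obtain ⟨g, rfl⟩ := h.exists_smul_eq h'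
  exact hX.1 c g s hs

section Representation

variable {B Γ : Type} [AddCommGroup Γ] {W : Type v} (π : W → Pt.{u} k × B)
  (ec : ZMod (2 * k + 1) × B → ZMod (2 * k + 1) × B → Γ) (tc : ℕ × Colour k → Γ)
  (ρ : Γ → Colour k)

/-- The relation over `W` that represents an element of the split algebra. -/
def represent (X : ColouredSets α (Pt.{u} k) (Colour k)) : Set (Fin α → W) :=
  X.realize (fun x => (π x).1) fun w => ρ (colouring ec tc (π ∘ w))

variable {π ec tc ρ}

theorem mem_represent {X : ColouredSets α (Pt.{u} k) (Colour k)} {w : Fin α → W} :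
    w ∈ represent π ec tc ρ X ↔
      (fun i => (π (w i)).1) ∈ X (ρ (colouring ec tc (π ∘ w))) := Iff.rfl

open FirstOrder.Language.Structure in
theorem represent_join (x : Fin 2 → ColouredSets α (Pt.{u} k) (Colour k)) :
    represent π ec tc ρ (funMap (L := polyadicLanguage α) PolyadicOp.join x) =
      represent π ec tc ρ (x 0) ∪ represent π ec tc ρ (x 1) := rfl

open FirstOrder.Language.Structure in
theorem represent_compl (x : Fin 1 → ColouredSets α (Pt.{u} k) (Colour k)) :
    represent π ec tc ρ (funMap (L := polyadicLanguage α) PolyadicOp.compl x) =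
      (represent π ec tc ρ (x 0))ᶜ := rfl

open FirstOrder.Language.Structure in
theorem represent_diag (hπ : Function.Injective fun x => (π x).1) (i j : Fin α)
    (x : Fin 0 → ColouredSets α (Pt.{u} k) (Colour k)) :
    represent π ec tc ρ (funMap (L := polyadicLanguage α) (PolyadicOp.diag i j) x) =
      setDiag W i j := by
  ext w
  exact hπ.eq_iff

open FirstOrder.Language.Structure in
theorem represent_transp (hec : ∀ x y, ec x y = ec y x) (i j : Fin α)
    (x : Fin 1 → ColouredSets α (Pt.{u} k) (Colour k)) (hx : x 0 ∈ splitAlgebra α k) :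
    represent π ec tc ρ (funMap (L := polyadicLanguage α) (PolyadicOp.transp i j) x) =
      setTransp i j (represent π ec tc ρ (x 0)) := by
  ext w
  rw [mem_setTransp, mem_represent, mem_represent, ColouredSets.mem_funMap_transp]
  change (fun l => (π (w (Equiv.swap i j l))).1) ∈ _ ↔
    (fun l => (π (w (Equiv.swap i j l))).1) ∈ x 0 (ρ (colouring ec tc ((π ∘ w) ∘ Equiv.swap i j)))
  by_cases h : (fun l => (π (w l)).1) ∈ edgeSet α k
  · rw [colouring_comp_swap (w := π ∘ w) hec h]
  · have h' : (fun l => (π (w (Equiv.swap i j l))).1) ∉ edgeSet α k := fun e =>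
      h (mem_edgeSet_of_comp_swap i j _ e)
    exact ⟨hx.2 _ h' _ _, hx.2 _ h' _ _⟩

open FirstOrder.Language.Structure in
-- The abstract cylindrification accepts a witness of any colour `c`, so the concrete one must find
-- a witness whose actual colour behaves like `c`. Off the edges colour is irrelevant; on them
-- `EdgeAt.recolour` changes the entry at `i`, and the single orbit makes the new edge as good as
-- the old.
theorem represent_cyl (hπ : Function.Surjective π) (htc : ∀ γ, {v | tc v = γ}.Infinite)
    (hleft : ∀ x γ, ∃ y : ZMod (2 * k + 1) × B, y.1 ≠ x.1 ∧ ec x y = γ)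
    (hright : ∀ y γ, ∃ x : ZMod (2 * k + 1) × B, x.1 ≠ y.1 ∧ ec x y = γ) (i : Fin α)
    (x : Fin 1 → ColouredSets α (Pt.{u} k) (Colour k)) (hx : x 0 ∈ splitAlgebra α k)
    (hρ : ∀ c, ∃ γ, x 0 c = x 0 (ρ γ)) :
    represent π ec tc ρ (funMap (L := polyadicLanguage α) (PolyadicOp.cyl i) x) =
      setCyl i (represent π ec tc ρ (x 0)) := by
  classical
  ext w
  rw [mem_represent, ColouredSets.mem_funMap_cyl, mem_setCyl]
  constructor
  · rintro ⟨a, c, ha⟩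
    have hB : Nonempty B := ⟨(π (w i)).2⟩
    obtain ⟨b⟩ := hB
    obtain ⟨y, hy⟩ := hπ (a, b)
    have hw : (fun l => (π (Function.update w i y l)).1) =
        Function.update (fun l => (π (w l)).1) i a := by
      funext l
      by_cases hl : l = i
      · subst hl; simp [hy]
      · simp [hl]
    rw [← hw] at ha
    by_cases hQ : (fun l => (π (Function.update w i y l)).1) ∈ edgeSet α k
    · obtain ⟨p, q, hpq⟩ := hQ
      obtain ⟨γ, hγ⟩ := hρ c
      obtain ⟨z, hz, hzc⟩ := EdgeAt.recolour (w := fun l => π (Function.update w i y l))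
        htc hleft hright hpq i γ
      obtain ⟨z, rfl⟩ := hπ z
      have hu : Function.update (fun l => π (Function.update w i y l)) i (π z) =
          π ∘ Function.update w i z := by
        funext l
        by_cases hl : l = i
        · subst hl; simp
        · simp [hl]
      rw [hu] at hz hzc
      refine ⟨z, mem_represent.2 ?_⟩
      rw [hzc, ← hγ]
      exact splitAlgebra_mem_of_edgeAt hx hpq hz ha
    · exact ⟨y, hx.2 _ hQ _ _ ha⟩
  · rintro ⟨y, hy⟩
    refine ⟨(π y).1, ρ (colouring ec tc (π ∘ Function.update w i y)), ?_⟩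
    rw [mem_represent] at hy
    convert hy using 1
    funext l
    by_cases hl : l = i
    · subst hl; simp
    · simp [hl]

/-- A third position carries a tail point, and recolouring it alone shows every colour at every edge
orbit; hence nothing is asked of `ec`. -/
theorem represent_injOn (hα : 3 ≤ α) [Nonempty B] (hπ : Function.Surjective π)
    (htc : ∀ γ, {v | tc v = γ}.Infinite) {T : Set (ColouredSets α (Pt.{u} k) (Colour k))}
    (hT : T ⊆ splitAlgebra α k) (hρ : ∀ c, ∃ γ, ∀ X ∈ T, X c = X (ρ γ)) :
    Set.InjOn (represent (α := α) π ec tc ρ) T := by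
  classical
  have key : ∀ X ∈ T, ∀ Y ∈ T, represent π ec tc ρ X ⊆ represent π ec tc ρ Y →
      ∀ c, X c ⊆ Y c := by
    intro X hX Y hY hXY c s hs
    have hsurj : Function.Surjective fun x => (π x).1 := Prod.fst_surjective.comp hπ
    obtain ⟨w, rfl⟩ : ∃ w : Fin α → W, (fun l => (π (w l)).1) = s :=
      ⟨fun l => (hsurj (s l)).choose, funext fun l => (hsurj (s l)).choose_spec⟩
    by_cases hQ : (fun l => (π (w l)).1) ∈ edgeSet α k
    · obtain ⟨p, q, hpq⟩ := hQ
      obtain ⟨γ, hγ⟩ := hρ c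
      obtain ⟨i, hi⟩ : ∃ i : Fin α, i ∉ ({p, q} : Finset (Fin α)) := by
        by_contra! hall
        have := Finset.card_le_card (fun i _ => hall i : Finset.univ ⊆ {p, q})
        have h2 := Finset.card_le_two (a := p) (b := q)
        simp at this
        omega
      simp only [Finset.mem_insert, Finset.mem_singleton, not_or] at hi
      obtain ⟨z, hz, hzc⟩ := EdgeAt.recolour_tail (ec := ec) (w := fun l => π (w l))
        htc hpq hi.1 hi.2 γ
      obtain ⟨z, rfl⟩ := hπ z
      have hu : Function.update (fun l => π (w l)) i (π z) = π ∘ Function.update w i z :=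
        (Function.comp_update π w i z).symm
      rw [hu] at hz hzc
      have h1 : Function.update w i z ∈ represent π ec tc ρ X := by
        rw [mem_represent, hzc, ← hγ X hX]
        exact splitAlgebra_mem_of_edgeAt (hT hX) hpq hz hs
      have h2 := hXY h1
      rw [mem_represent, hzc, ← hγ Y hY] at h2
      exact splitAlgebra_mem_of_edgeAt (hT hY) hz hpq h2
    · exact (hT hY).2 _ hQ _ _ (hXY ((hT hX).2 _ hQ _ _ hs : w ∈ represent π ec tc ρ X))
  intro X hX Y hY hXY
  funext c
  exact (key X hX Y hY hXY.subset c).antisymm (key Y hY X hX hXY.symm.subset c)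

end Representation

/-! ### Cyclic edge colours on an odd number of vertices. -/

section EdgeColour

variable (k : ℕ)

/-- The length of the shorter arc between two vertices. -/
def arcLength (a b : ZMod (2 * k + 1)) : ZMod k := ((b - a).valMinAbs.natAbs : ZMod k)

/-- The direction of the shorter arc between two vertices. -/
def arcDirection (a b : ZMod (2 * k + 1)) : ZMod 2 := if 0 < (b - a).valMinAbs then 0 else 1

variable {k}

theorem arcLength_comm (a b : ZMod (2 * k + 1)) : arcLength k a b = arcLength k b a := by
  unfold arcLength
  rw [← neg_sub b a, ZMod.natAbs_valMinAbs_neg]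

theorem exists_difference [NeZero k] (c : Colour k) : ∃ d : ZMod (2 * k + 1), d ≠ 0 ∧
    (d.valMinAbs.natAbs : ZMod k) = c.1 ∧ (if 0 < d.valMinAbs then 0 else 1 : ZMod 2) = c.2 := by
  obtain ⟨γ, ε⟩ := c
  -- Representatives are taken in `1, …, k`: the zero class is represented by `k`, as the difference
  -- must not vanish.
  obtain ⟨j, hj0, hjk, hj⟩ : ∃ j : ℕ, 0 < j ∧ j ≤ k ∧ (j : ZMod k) = γ := by
    by_cases h : γ = 0
    · exact ⟨k, NeZero.pos k, le_rfl, by simp [h]⟩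
    · exact ⟨γ.val, ZMod.val_pos.2 h, (ZMod.val_lt γ).le, by simp⟩
  have hv : ((j : ZMod (2 * k + 1))).valMinAbs = j :=
    ZMod.valMinAbs_natCast_of_le_half (by omega)
  have hne : (j : ZMod (2 * k + 1)) ≠ 0 := by
    rw [Ne, ← ZMod.valMinAbs_eq_zero, hv]
    omega
  have hε : ε = 0 ∨ ε = 1 := by
    revert ε
    decide
  rcases hε with rfl | rfl
  · exact ⟨j, hne, by simp [hv, hj], by simp [hv, hj0]⟩
  · have hneg : (-(j : ZMod (2 * k + 1))).valMinAbs = -j := by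
      rw [ZMod.valMinAbs_neg_of_ne_half (by omega), hv]
    exact ⟨-j, neg_ne_zero.2 hne, by simp [hneg, hj], by simp [hneg]⟩

theorem infinite_tail_colour [NeZero k] (c : Colour k) :
    {v : ℕ × Colour k | v.2 = c}.Infinite :=
  Set.infinite_of_injective_forall_mem (f := fun n : ℕ => (n, c))
    (fun _ _ h => congrArg Prod.fst h) fun _ => rfl

end EdgeColour

end SplitAlgebra

/-! ### Representations of the reducts and of the small subalgebras. -/

section SplitAlgebraRepresentations

open FirstOrder.Language

variable {α k : ℕ}

/-- The base of the representations without multiplied points. -/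
def unitBase (x : Pt.{v} k) : Pt.{u} k × Unit := (Pt.liftEquiv x, ())

theorem unitBase_surjective : Function.Surjective (unitBase.{u, v} (k := k)) := fun x =>
  ⟨Pt.liftEquiv.symm x.1, by simp [unitBase]⟩

theorem unitBase_fst_injective : Function.Injective fun x => (unitBase.{u, v} (k := k) x).1 :=
  Pt.liftEquiv.injective

/-- The base of the representation in which each point is doubled. -/
def doubleBase (x : Pt.{v} k × ZMod 2) : Pt.{u} k × ZMod 2 := (Pt.liftEquiv x.1, x.2)

theorem doubleBase_surjective : Function.Surjective (doubleBase.{u, v} (k := k)) := fun x =>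
  ⟨(Pt.liftEquiv.symm x.1, x.2), by simp [doubleBase]⟩

theorem splitAlgebra_cylFree (hα : 3 ≤ α) [NeZero k] :
    ReductIsoToSubPse.{u, v} α (cylFreeOps α) (splitAlgebra.{u} α k) := by
  let φ : splitAlgebra.{u} α k → Set (Fin α → Pt.{v} k) := fun X =>
    represent unitBase (fun _ _ => (0 : Colour k)) Prod.snd id X.1
  have hinj : Function.Injective φ := fun X Y h => Subtype.ext
    (represent_injOn hα unitBase_surjective infinite_tail_colour subset_rfl
      (fun c => ⟨c, fun _ _ => rfl⟩) X.2 Y.2 h)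
  refine reductIsoToSubPse_of_embedding φ hinj fun {n} f hf x => ?_
  match n, f with
  | _, .join => exact represent_join fun i => (x i).1
  | _, .compl => exact represent_compl fun i => (x i).1
  | _, .cyl i => exact absurd trivial hf
  | _, .diag i j => exact represent_diag unitBase_fst_injective i j fun i => (x i).1
  | _, .transp i j => exact represent_transp (fun _ _ => rfl) i j (fun i => (x i).1) (x 0).2

/-- Without diagonals each point may have a twin. The sum of the twin indices is a symmetric second
colour coordinate, and choosing the twin of the other endpoint gives it any value. -/
theorem splitAlgebra_diagFree (hα : 3 ≤ α) [NeZero k] :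
    ReductIsoToSubPse.{u, v} α (diagFreeOps α) (splitAlgebra.{u} α k) := by
  let ec : ZMod (2 * k + 1) × ZMod 2 → ZMod (2 * k + 1) × ZMod 2 → Colour k :=
    fun x y => (arcLength k x.1 y.1, x.2 + y.2)
  have hec : ∀ x y, ec x y = ec y x := fun x y => by
    exact Prod.ext (arcLength_comm _ _) (add_comm _ _)
  have hleft : ∀ x γ, ∃ y : ZMod (2 * k + 1) × ZMod 2, y.1 ≠ x.1 ∧ ec x y = γ := fun x γ => by
    obtain ⟨d, hd, hd1, -⟩ := exists_difference γ
    refine ⟨(x.1 + d, γ.2 - x.2), by simpa using hd, Prod.ext ?_ ?_⟩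
    · simpa [ec, arcLength] using hd1
    · simp [ec]
  let φ : splitAlgebra.{u} α k → Set (Fin α → Pt.{v} k × ZMod 2) := fun X =>
    represent doubleBase ec Prod.snd id X.1
  have hinj : Function.Injective φ := fun X Y h => Subtype.ext
    (represent_injOn hα doubleBase_surjective infinite_tail_colour subset_rfl
      (fun c => ⟨c, fun _ _ => rfl⟩) X.2 Y.2 h)
  refine reductIsoToSubPse_of_embedding φ hinj fun {n} f hf x => ?_
  match n, f with
  | _, .join => exact represent_join fun i => (x i).1
  | _, .compl => exact represent_compl fun i => (x i).1
  | _, .cyl i =>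
    exact represent_cyl doubleBase_surjective infinite_tail_colour hleft
      (fun y γ => (hleft y γ).imp fun z hz => ⟨hz.1, (hec z y).trans hz.2⟩) i
      (fun i => (x i).1) (x 0).2 fun c => ⟨c, rfl⟩
  | _, .diag i j => exact absurd trivial hf
  | _, .transp i j => exact represent_transp hec i j (fun i => (x i).1) (x 0).2

/-- Without transpositions the colour may be oriented. The nonzero differences `b - a` correspond to
all `2k` pairs of length and direction, so every colour leaves and enters each vertex. -/
theorem splitAlgebra_transpFree (hα : 3 ≤ α) [NeZero k] :
    ReductIsoToSubPse.{u, v} α (transpFreeOps α) (splitAlgebra.{u} α k) := by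
  let ec : ZMod (2 * k + 1) × Unit → ZMod (2 * k + 1) × Unit → Colour k :=
    fun x y => (arcLength k x.1 y.1, arcDirection k x.1 y.1)
  have hleft : ∀ x γ, ∃ y : ZMod (2 * k + 1) × Unit, y.1 ≠ x.1 ∧ ec x y = γ := fun x γ => by
    obtain ⟨d, hd, hd1, hd2⟩ := exists_difference γ
    refine ⟨(x.1 + d, ()), by simpa using hd, Prod.ext ?_ ?_⟩
    · simpa [ec, arcLength] using hd1
    · simpa [ec, arcDirection] using hd2
  have hright : ∀ y γ, ∃ x : ZMod (2 * k + 1) × Unit, x.1 ≠ y.1 ∧ ec x y = γ := fun y γ => by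
    obtain ⟨d, hd, hd1, hd2⟩ := exists_difference γ
    refine ⟨(y.1 - d, ()), by simpa using hd, Prod.ext ?_ ?_⟩
    · simpa [ec, arcLength] using hd1
    · simpa [ec, arcDirection] using hd2
  let φ : splitAlgebra.{u} α k → Set (Fin α → Pt.{v} k) := fun X =>
    represent unitBase ec Prod.snd id X.1
  have hinj : Function.Injective φ := fun X Y h => Subtype.ext
    (represent_injOn hα unitBase_surjective infinite_tail_colour subset_rfl
      (fun c => ⟨c, fun _ _ => rfl⟩) X.2 Y.2 h)
  refine reductIsoToSubPse_of_embedding φ hinj fun {n} f hf x => ?_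
  match n, f with
  | _, .join => exact represent_join fun i => (x i).1
  | _, .compl => exact represent_compl fun i => (x i).1
  | _, .cyl i =>
    exact represent_cyl unitBase_surjective infinite_tail_colour hleft hright i
      (fun i => (x i).1) (x 0).2 fun c => ⟨c, rfl⟩
  | _, .diag i j => exact represent_diag unitBase_fst_injective i j fun i => (x i).1
  | _, .transp i j => exact absurd trivial hf

/-- A subalgebra that distinguishes at most `k` colours is representable. -/
theorem splitAlgebra_isoToPse_of_few_colours (hα : 3 ≤ α) [NeZero k]
    (S : (polyadicLanguage α).Substructure (splitAlgebra.{u} α k)) (ρ : ZMod k → Colour k)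
    (hρ : ∀ c, ∃ γ, ∀ X ∈ S, X.1 c = X.1 (ρ γ)) : IsoToPse.{u, v} α S := by
  let ec : ZMod (2 * k + 1) × Unit → ZMod (2 * k + 1) × Unit → ZMod k :=
    fun x y => arcLength k x.1 y.1
  have hec : ∀ x y, ec x y = ec y x := fun x y => arcLength_comm _ _
  have hleft : ∀ x γ, ∃ y : ZMod (2 * k + 1) × Unit, y.1 ≠ x.1 ∧ ec x y = γ := fun x γ => by
    obtain ⟨d, hd, hd1, -⟩ := exists_difference ((γ, 0) : Colour k)
    refine ⟨(x.1 + d, ()), by simpa using hd, ?_⟩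
    simpa [ec, arcLength] using hd1
  have htc : ∀ γ : ZMod k, {v : ℕ × Colour k | v.2.1 = γ}.Infinite := fun γ =>
    (infinite_tail_colour (γ, 0)).mono fun v (hv : v.2 = (γ, 0)) => congrArg Prod.fst hv
  let φ : S → Set (Fin α → Pt.{v} k) := fun X => represent unitBase ec (fun v => v.2.1) ρ X.1.1
  have hinj : Function.Injective φ := fun X Y h => Subtype.ext <| Subtype.ext
    (represent_injOn (T := Subtype.val '' (S : Set (splitAlgebra.{u} α k))) hα unitBase_surjective
      htc (by rintro _ ⟨X, -, rfl⟩; exact X.2)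
      (fun c => (hρ c).imp fun γ hγ => by rintro _ ⟨X, hX, rfl⟩; exact hγ X hX)
      ⟨X.1, X.2, rfl⟩ ⟨Y.1, Y.2, rfl⟩ h)
  refine isoToPse_of_embedding φ hinj fun {n} f x => ?_
  match n, f with
  | _, .join => exact represent_join fun i => (x i).1.1
  | _, .compl => exact represent_compl fun i => (x i).1.1
  | _, .cyl i =>
    exact represent_cyl unitBase_surjective htc hleft
      (fun y γ => (hleft y γ).imp fun z hz => ⟨hz.1, (hec z y).trans hz.2⟩) i
      (fun i => (x i).1.1) (x 0).1.2 fun c => (hρ c).imp fun γ hγ => hγ _ (x 0).2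
  | _, .diag i j => exact represent_diag unitBase_fst_injective i j fun i => (x i).1.1
  | _, .transp i j => exact represent_transp hec i j (fun i => (x i).1.1) (x 0).1.2

/-- If `k` is large compared with `n`, the `n`-generated subalgebras are representable. -/
theorem splitAlgebra_isoToPse_of_isNGenerated (hα : 3 ≤ α) {n : ℕ} [NeZero k]
    (hk : 2 ^ (α * α * n) ≤ k) (S : (polyadicLanguage α).Substructure (splitAlgebra.{u} α k))
    (hS : IsNGenerated n S) : IsoToPse.{u, v} α S := by
  classical
  obtain ⟨X, hX, rfl⟩ := hS
  have hfin : X.Finite := Set.finite_of_encard_le_coe hX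
  have hcard : Nat.card X ≤ n := by
    rw [Nat.card_coe_set_eq]
    rw [← hfin.cast_ncard_eq] at hX
    exact_mod_cast hX
  have := hfin.fintype
  -- Since edges at fixed positions form one orbit, a generator restricted to a colour is determined
  -- on the edges by the set of position pairs it contains. Colours with equal signatures cannot be
  -- separated by the generators, nor by anything generated from them.
  let f : Colour k → X → Set (Fin α × Fin α) := fun c Y =>
    {pq | ∃ s, EdgeAt pq.1 pq.2 s ∧ s ∈ Y.1.1 c}
  have hf : ∀ Y ∈ Substructure.closure (polyadicLanguage α) X, ∀ c c', f c = f c' → Y.1 c = Y.1 c' := by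
    intro Y hY
    refine Substructure.closure_induction (p := fun Y => ∀ c c', f c = f c' → Y.1 c = Y.1 c') hY ?_ ?_
    · intro Y hY
      have key : ∀ c c', f c = f c' → Y.1 c ⊆ Y.1 c' := by
        intro c c' h s hs
        by_cases hQ : s ∈ edgeSet α k
        · obtain ⟨p, q, hpq⟩ := hQ
          have hmem : (p, q) ∈ f c ⟨Y, hY⟩ := ⟨s, hpq, hs⟩
          rw [h] at hmem
          obtain ⟨s', hs', hs''⟩ := hmem
          exact splitAlgebra_mem_of_edgeAt Y.2 hs' hpq hs''
        · exact Y.2.2 s hQ c c' hs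
      exact fun c c' h => (key c c' h).antisymm (key c' c h.symm)
    · intro m g x hx c c' h
      match m, g with
      | _, .join => exact congrArg₂ (· ∪ ·) (hx 0 c c' h) (hx 1 c c' h)
      | _, .compl => exact congrArg compl (hx 0 c c' h)
      | _, .cyl i => rfl
      | _, .diag i j => rfl
      | _, .transp i j => exact congrArg (setTransp i j) (hx 0 c c' h)
  -- Each generator admits `2^(α·α)` sets of position pairs, so there are at most `2^(α·α·n)`
  -- signatures.
  have hle : Fintype.card (Set.range f) ≤ Fintype.card (ZMod k) := by
    refine (Fintype.card_subtype_le _).trans ?_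
    rw [ZMod.card]
    refine le_trans ?_ hk
    simp only [Fintype.card_pi, Fintype.card_set, Fintype.card_prod, Fintype.card_fin,
      Finset.prod_const, Finset.card_univ, ← pow_mul]
    rw [← Nat.card_eq_fintype_card]
    gcongr
    norm_num
  obtain ⟨e⟩ := Function.Embedding.nonempty_of_card_le hle
  have : Nonempty (Set.range f) := ⟨⟨_, 0, rfl⟩⟩
  refine splitAlgebra_isoToPse_of_few_colours hα _
    -- One colour is chosen for each signature; elements of `ZMod k` outside the image of `e`
    -- receive an arbitrary one.
    (fun γ => (Function.invFun e γ).2.choose) fun c => ⟨e ⟨f c, c, rfl⟩, fun Y hY => ?_⟩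
  refine hf Y hY _ _ ?_
  rw [(Function.invFun e (e ⟨f c, c, rfl⟩)).2.choose_spec,
    Function.leftInverse_invFun e.injective]

end SplitAlgebraRepresentations

/-- A complete graph on an odd number of vertices has no one-factorization, even if its edges
are only assumed to be coloured with too many colours present at each vertex. -/
theorem not_symmetric_split {N C : Type*} [Fintype N] [Fintype C] [Nonempty N] [Nonempty C]
    (hcard : Fintype.card N ≤ Fintype.card C + 1) (heven : Even (Fintype.card C))
    (E : C → N → N → Prop) (symm : ∀ c x y, E c x y → E c y x) (irrefl : ∀ c x, ¬ E c x x)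
    (disj : ∀ c c' x y, E c x y → E c' x y → c = c') (total : ∀ c x, ∃ y, E c x y) : False := by
  classical
  choose P hP using total
  have hinj : ∀ x, Function.Injective fun c => (⟨P c x, fun e => irrefl c x (by
      have := hP c x; rwa [e] at this)⟩ : {y // y ≠ x}) := fun x c c' h =>
    disj c c' x _ (hP c x) (by
      have : P c x = P c' x := congrArg Subtype.val h
      rw [this]
      exact hP c' x)
  have hle : ∀ x : N, Fintype.card {y // y ≠ x} ≤ Fintype.card C := fun x => by
    rw [Fintype.card_subtype_compl, Fintype.card_subtype_eq]
    omega
  -- Distinct colours lead from `x` to distinct neighbours, and there are no more other vertices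
  -- than colours, so every other vertex is reached exactly once.
  have hbij : ∀ x, Function.Bijective fun c => (⟨P c x, fun e => irrefl c x (by
      have := hP c x; rwa [e] at this)⟩ : {y // y ≠ x}) := fun x =>
    (Fintype.bijective_iff_injective_and_card _).2
      ⟨hinj x, (Fintype.card_le_of_injective _ (hinj x)).antisymm (hle x)⟩
  have hunique : ∀ c x y, E c x y → P c x = y := by
    intro c x y h
    obtain ⟨c', hc'⟩ := (hbij x).2 ⟨y, fun e => irrefl c x (by rwa [e] at h)⟩
    have hc : P c' x = y := congrArg Subtype.val hc'
    have := disj c c' x y h (by rw [← hc]; exact hP c' x)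
    rw [this, hc]
  obtain ⟨c⟩ := ‹Nonempty C›
  obtain ⟨x⟩ := ‹Nonempty N›
  have hinv : Function.Involutive (P c) := fun x => hunique c _ _ (symm c _ _ (hP c x))
  have hN : Fintype.card N = Fintype.card C + 1 := by
    have := Fintype.card_of_bijective (hbij x)
    rw [Fintype.card_subtype_compl, Fintype.card_subtype_eq] at this
    have := Fintype.card_pos_iff.2 ⟨x⟩
    omega
  have : Fact (Nat.Prime 2) := ⟨Nat.prime_two⟩
  -- An involution of a set of odd size has a fixed point, which would be a loop of colour `c`.
  obtain ⟨y, hy⟩ := Equiv.Perm.exists_fixed_point_of_prime (p := 2) (n := 1)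
    (by rw [hN]; exact (heven.add_one).not_two_dvd_nat) (σ := hinv.toPerm)
    (Equiv.ext fun z => by simpa [pow_two] using hinv z)
  exact irrefl c y (by have := hP c y; rwa [show P c y = y from hy] at this)

/-! ### Non-representability of the split algebra. -/

section NonRepresentability

open FirstOrder.Language FirstOrder.Language.Structure

variable {α k : ℕ}

theorem EdgeAt.smul {p q : Fin α} {s : Fin α → Pt.{u} k} (h : EdgeAt p q s) (g : Pt.Sym k) :
    EdgeAt p q (g • s) := by
  obtain ⟨hpq, hs, ⟨a, ha⟩, ⟨b, hb⟩, ht⟩ := h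
  refine ⟨hpq, (MulAction.injective g).comp hs, ⟨g.1 a, by simp [ha]⟩, ⟨g.1 b, by simp [hb]⟩,
    fun j hp hq => ?_⟩
  obtain ⟨v, hv⟩ := ht j hp hq
  exact ⟨g.2 v, by simp [hv]⟩

theorem exists_edgeAt [NeZero k] {p q : Fin α} (hpq : p ≠ q) :
    ∃ s : Fin α → Pt.{u} k, EdgeAt p q s := by
  classical
  have h01 : (0 : ZMod (2 * k + 1)) ≠ 1 := by
    have : Fact (1 < 2 * k + 1) := ⟨by have := NeZero.pos k; omega⟩
    exact zero_ne_one
  refine ⟨fun j => if j = p then .vertex 0 else if j = q then .vertex 1 else .tail (j, 0),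
    hpq, fun i j hij => ?_, ⟨0, by simp⟩, ⟨1, by simp [hpq.symm]⟩,
    fun j hp hq => ⟨(j, 0), by simp [hp, hq]⟩⟩
  by_contra hne
  dsimp only at hij
  split_ifs at hij <;> simp_all [Fin.val_inj]

namespace splitAlgebra

/-- An invariant relation, as a colour-independent element of the split algebra. -/
def ofInvariant (Y : Set (Fin α → Pt.{u} k)) (hY : ∀ (g : Pt.Sym k), ∀ s ∈ Y, g • s ∈ Y) :
    splitAlgebra.{u} α k :=
  ⟨fun _ => Y, fun _ g s hs => hY g s hs, fun _ _ _ _ hs => hs⟩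

/-- The part of the given colour of the edges at the positions `p` and `q`. -/
def part (p q : Fin α) (c : Colour k) : splitAlgebra.{u} α k :=
  ⟨fun d => {s | d = c ∧ EdgeAt p q s}, fun _ g _ hs => ⟨hs.1, hs.2.smul g⟩,
    fun _ hs _ _ h => absurd ⟨p, q, h.2⟩ hs⟩

/-- The sequences with a vertex at the position `p`. -/
def vertexAt (p : Fin α) : splitAlgebra.{u} α k :=
  ofInvariant {s | ∃ a, s p = .vertex a} fun g s ⟨a, ha⟩ => ⟨g.1 a, by simp [ha]⟩

/-- The sequences with a labelling at the position `r`. -/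
def labellingAt (r : Fin α) : splitAlgebra.{u} α k :=
  ofInvariant {s | ∃ t, s r = .labelling t} fun g s ⟨t, ht⟩ => ⟨g.1 * t, by simp [ht]⟩

/-- The sequences with a vertex at the position `p` and a labelling at the position `r`. -/
def labelledVertexAt (p r : Fin α) : splitAlgebra.{u} α k :=
  ofInvariant {s | (∃ a, s p = .vertex a) ∧ ∃ t, s r = .labelling t}
    fun g s ⟨⟨a, ha⟩, t, ht⟩ => ⟨⟨g.1 a, by simp [ha]⟩, g.1 * t, by simp [ht]⟩

/-- The sequences whose entry at `p` is labelled `a` by the labelling at `r`. -/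
def labelledAt (p r : Fin α) (a : ZMod (2 * k + 1)) : splitAlgebra.{u} α k :=
  ofInvariant {s | ∃ t, s r = .labelling t ∧ s p = .vertex (t a)}
    fun g s ⟨t, ht, ha⟩ => ⟨g.1 * t, by simp [ht], by simp [ha]⟩

section Hom

variable {W : Type v} (φ : splitAlgebra.{u} α k →[polyadicLanguage α] Set (Fin α → W))
  {X Y Z : splitAlgebra.{u} α k}

/-- The union of two elements. -/
def join (X Y : splitAlgebra.{u} α k) : splitAlgebra.{u} α k :=
  funMap (L := polyadicLanguage α) PolyadicOp.join ![X, Y]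

/-- The complement of an element. -/
def compl (X : splitAlgebra.{u} α k) : splitAlgebra.{u} α k :=
  funMap (L := polyadicLanguage α) PolyadicOp.compl ![X]

/-- The cylindrification of an element. -/
def cyl (i : Fin α) (X : splitAlgebra.{u} α k) : splitAlgebra.{u} α k :=
  funMap (L := polyadicLanguage α) (PolyadicOp.cyl i) ![X]

/-- The transposition of an element. -/
def transp (i j : Fin α) (X : splitAlgebra.{u} α k) : splitAlgebra.{u} α k :=
  funMap (L := polyadicLanguage α) (PolyadicOp.transp i j) ![X]

/-- The diagonal elements. -/
def diag (i j : Fin α) : splitAlgebra.{u} α k :=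
  funMap (L := polyadicLanguage α) (PolyadicOp.diag i j) ![]

theorem map_cyl (i : Fin α) : φ (cyl i X) = setCyl i (φ X) :=
  φ.map_fun (PolyadicOp.cyl i : (polyadicLanguage α).Functions 1) ![X]

theorem map_transp (i j : Fin α) : φ (transp i j X) = setTransp i j (φ X) :=
  φ.map_fun (PolyadicOp.transp i j : (polyadicLanguage α).Functions 1) ![X]

theorem map_diag (i j : Fin α) : φ (diag i j) = setDiag W i j :=
  φ.map_fun (PolyadicOp.diag i j : (polyadicLanguage α).Functions 0) ![]

theorem map_join : φ (join X Y) = φ X ∪ φ Y :=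
  φ.map_fun (PolyadicOp.join : (polyadicLanguage α).Functions 2) ![X, Y]

theorem map_compl : φ (compl X) = (φ X)ᶜ :=
  φ.map_fun (PolyadicOp.compl : (polyadicLanguage α).Functions 1) ![X]

/-- Inclusion is the equation `join X Y = Y`. The lemmas that follow transfer pointwise facts
through this inclusion principle. -/
theorem map_mono (h : ∀ c, X.1 c ⊆ Y.1 c) : φ X ⊆ φ Y := by
  have hXY : join X Y = Y := Subtype.ext (funext fun c => Set.union_eq_right.2 (h c))
  rw [← Set.union_eq_right, ← map_join, hXY]

theorem map_disjoint (h : ∀ c s, s ∈ X.1 c → s ∉ Y.1 c) {w : Fin α → W} (hX : w ∈ φ X) :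
    w ∉ φ Y := by
  have := map_mono φ (X := X) (Y := compl Y) fun c s hs => h c s hs
  rw [map_compl] at this
  exact this hX

theorem map_inter (h : ∀ c s, s ∈ X.1 c → s ∈ Y.1 c → s ∈ Z.1 c) {w : Fin α → W}
    (hX : w ∈ φ X) (hY : w ∈ φ Y) : w ∈ φ Z := by
  have : φ X ⊆ φ (join (compl Y) Z) := map_mono φ fun c s hs => by
    by_cases hs' : s ∈ Y.1 c
    · exact Or.inr (h c s hs hs')
    · exact Or.inl hs'
  rw [map_join, map_compl] at this
  exact (this hX).resolve_left fun h => h hY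

theorem mem_map_of_swap {i j : Fin α} (h : ∀ c s, s ∘ Equiv.swap i j ∈ X.1 c → s ∈ Y.1 c)
    {w : Fin α → W} (hw : w ∘ Equiv.swap i j ∈ φ X) : w ∈ φ Y := by
  refine map_mono φ (X := transp i j X)
    (fun c s hs => h c s (ColouredSets.mem_funMap_transp.1 hs)) ?_
  rw [map_transp]
  exact mem_setTransp.2 hw

theorem mem_map_update {i : Fin α} (h : ∀ c d s a, Function.update s i a ∈ X.1 d → s ∈ X.1 c)
    {w : Fin α → W} {a : W} (hw : w ∈ φ X) : Function.update w i a ∈ φ X := by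
  refine map_mono φ (X := cyl i X)
    (fun c s hs => ?_) ?_
  · obtain ⟨a, d, had⟩ := ColouredSets.mem_funMap_cyl.1 hs
    exact h c d s a had
  · rw [map_cyl]
    exact mem_setCyl.2 ⟨w i, by simpa using hw⟩

theorem exists_update_mem_map {i : Fin α} (h : ∀ c s, s ∈ X.1 c → ∃ a d, Function.update s i a ∈ Y.1 d)
    {w : Fin α → W} (hw : w ∈ φ X) : ∃ a, Function.update w i a ∈ φ Y := by
  have := map_mono φ (Y := cyl i Y)
    (fun c s hs => ColouredSets.mem_funMap_cyl.2 (h c s hs)) hw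
  rw [map_cyl] at this
  exact mem_setCyl.1 this

theorem eq_of_mem_map {i j : Fin α} (h : ∀ c s, s ∈ X.1 c → s i = s j) {w : Fin α → W}
    (hw : w ∈ φ X) : w i = w j := by
  have := map_mono φ
    (Y := diag i j) (fun c s hs => h c s hs) hw
  rw [map_diag] at this
  exact this

theorem ne_of_mem_map {i j : Fin α} (h : ∀ c s, s ∈ X.1 c → s i ≠ s j) {w : Fin α → W}
    (hw : w ∈ φ X) : w i ≠ w j := by
  intro hij
  refine map_disjoint φ
    (Y := diag i j) (fun c s hs => h c s hs) hw ?_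
  rw [map_diag]
  exact hij

theorem map_empty : φ (ofInvariant ∅ fun _ _ h => h) = ∅ :=
  Set.eq_empty_of_forall_notMem fun _ hw => map_disjoint φ (fun _ _ hs => absurd hs id) hw hw

theorem map_iUnion {ι : Type*} [Fintype ι] (Y : ι → splitAlgebra.{u} α k)
    (h : ∀ c s, s ∈ X.1 c → ∃ i, s ∈ (Y i).1 c) {w : Fin α → W} (hw : w ∈ φ X) :
    ∃ i, w ∈ φ (Y i) := by
  classical
  have key : ∀ t : Finset ι, ∃ Z : splitAlgebra.{u} α k, (∀ c, ∀ i ∈ t, (Y i).1 c ⊆ Z.1 c) ∧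
      ∀ w ∈ φ Z, ∃ i, w ∈ φ (Y i) := by
    intro t
    induction t using Finset.induction_on with
    | empty => exact ⟨ofInvariant ∅ fun _ _ h => h, by simp, by simp [map_empty]⟩
    | insert i t _ ih =>
      obtain ⟨Z, hZ, hZ'⟩ := ih
      refine ⟨join (Y i) Z, fun c j hj s hs => ?_, fun w hw => ?_⟩
      · rcases Finset.mem_insert.1 hj with rfl | hj
        · exact Or.inl hs
        · exact Or.inr (hZ c j hj hs)
      · rw [map_join] at hw
        exact hw.elim (fun h => ⟨i, h⟩) (hZ' w)
  obtain ⟨Z, hZ, hZ'⟩ := key Finset.univ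
  exact hZ' w (map_mono φ (fun c s hs => (h c s hs).elim fun i hi => hZ c i (by simp) hi) hw)

theorem not_injective_hom (hα : 3 ≤ α) [NeZero k] : ¬ Function.Injective φ := by
  classical
  intro hφ
  obtain ⟨p, q, r, hpq, hpr, hqr⟩ : ∃ p q r : Fin α, p ≠ q ∧ p ≠ r ∧ q ≠ r :=
    ⟨⟨0, by omega⟩, ⟨1, by omega⟩, ⟨2, by omega⟩, by simp, by simp, by simp⟩
  obtain ⟨w, hw⟩ : (φ (part p q 0)).Nonempty := by
    rw [Set.nonempty_iff_ne_empty, ← map_empty φ]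
    intro h
    obtain ⟨s, hs⟩ := exists_edgeAt.{u} (k := k) hpq
    have hs' : s ∈ (part p q (0 : Colour k)).1 0 := ⟨rfl, hs⟩
    rw [hφ h] at hs'
    exact hs'
  -- All coordinates of `w` except `p` and `q` stay frozen, so that the parts become binary
  -- relations on `W`.
  let seq : W → W → Fin α → W := fun x y => Function.update (Function.update w p x) q y
  have hseq : seq (w p) (w q) = w := by simp [seq]
  have hseq_swap : ∀ x y, seq x y ∘ Equiv.swap p q = seq y x := by
    intro x y
    funext l
    by_cases hp : l = p
    · subst hp; simp [seq, hpq]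
    by_cases hq : l = q
    · subst hq; simp [seq, hpq]
    · simp [seq, Equiv.swap_apply_of_ne_of_ne hp hq, hp, hq]
  let E : Colour k → W → W → Prop := fun c x y => seq x y ∈ φ (part p q c)
  have hsymm : ∀ c x y, E c x y → E c y x := fun c x y h =>
    mem_map_of_swap φ (X := part p q c) (Y := part p q c) (i := p) (j := q)
      (fun d s hs => ⟨hs.1, by
        have := hs.2.comp_perm (Equiv.swap p q)
        have hs' : (s ∘ Equiv.swap p q) ∘ Equiv.swap p q = s := by funext l; simp
        rw [hs'] at this
        simpa using this.symm⟩) (by rw [hseq_swap]; exact h)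
  have hirrefl : ∀ c x, ¬ E c x x := fun c x h =>
    ne_of_mem_map φ (X := part p q c) (i := p) (j := q) (fun d s hs e => hs.2.1 (hs.2.2.1 e)) h (by simp [seq, hpq])
  have hdisj : ∀ c c' x y, E c x y → E c' x y → c = c' := by
    intro c c' x y h h'
    by_contra hne
    exact map_disjoint φ (X := part p q c) (Y := part p q c') (fun d s hs hs' => hne (hs.1.symm.trans hs'.1)) h h'
  -- Cylindrification forgets the colour, so an edge of one colour at `x` forces one of every
  -- colour.
  have htotal : ∀ c c' x y, E c x y → ∃ z, E c' x z := by
    intro c c' x y h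
    obtain ⟨z, hz⟩ := exists_update_mem_map φ (i := q) (X := part p q c) (Y := part p q c')
      (fun d s hs => ⟨s q, c', rfl, by simpa using hs.2⟩) h
    exact ⟨z, by simpa [E, seq] using hz⟩
  -- One labelling point `t` is fixed for all vertices; it will bound their number.
  obtain ⟨t, ht⟩ := exists_update_mem_map φ (i := r) (Y := labellingAt r)
    (fun d s hs => ⟨.labelling 1, 0, 1, by simp⟩) hw
  let N : Set W := {x | ∃ c y, E c x y}
  -- The finitely many relations `labelledAt p r a` cover all labelled vertices. None depends on the
  -- coordinate `q`, so the label of `x` is independent of `y`.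
  have hlabel : ∀ x ∈ N, ∃ a : ZMod (2 * k + 1), ∀ y,
      Function.update (seq x y) r t ∈ φ (labelledAt p r a) := by
    rintro x ⟨c, y, hxy⟩
    have h1 : Function.update (seq x y) r t ∈ φ (vertexAt p) := by
      refine mem_map_update φ (X := vertexAt p) ?_ (map_mono φ (X := part p q c) (Y := vertexAt p)
        (fun d s hs => hs.2.2.2.1) hxy)
      rintro c d s a ⟨b, hb⟩
      exact ⟨b, by simpa [hpr] using hb⟩
    have h2 : Function.update (seq x y) r t ∈ φ (labellingAt r) := by
      have hcl : ∀ i, i ≠ r → ∀ (c d : Colour k) (s : Fin α → Pt.{u} k) a,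
          Function.update s i a ∈ (labellingAt (k := k) r).1 d → s ∈ (labellingAt r).1 c := by
        rintro i hi c d s a ⟨b, hb⟩
        exact ⟨b, by simpa [hi.symm] using hb⟩
      have := mem_map_update φ (a := y) (hcl q hqr) (mem_map_update φ (a := x) (hcl p hpr) ht)
      rwa [Function.update_comm hpr.symm, Function.update_comm hqr.symm] at this
    have h3 : Function.update (seq x y) r t ∈ φ (labelledVertexAt p r) :=
      map_inter φ (X := vertexAt p) (Y := labellingAt r) (Z := labelledVertexAt p r)
        (fun _ _ hs hs' => ⟨hs, hs'⟩) h1 h2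
    obtain ⟨a, ha⟩ := map_iUnion φ (X := labelledVertexAt p r) (fun a => labelledAt p r a) (by
      rintro c s ⟨⟨a, ha⟩, t, ht⟩
      exact ⟨t.symm a, t, ht, by simp [ha]⟩) h3
    refine ⟨a, fun z => ?_⟩
    have := mem_map_update φ (X := labelledAt p r a) (i := q) (a := z) (by
      rintro c d s b ⟨t, ht, hb⟩
      exact ⟨t, by simpa [hqr.symm] using ht, by simpa [hpq] using hb⟩) ha
    rw [Function.update_comm hqr.symm] at this
    simpa [seq] using this
  choose label hl using fun x : N => hlabel x.1 x.2
  -- Equal labels at `p` and, after a transposition, at `q` place the sequence in the diagonal,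
  -- because a labelling assigns each label to one vertex only.
  have hlinj : Function.Injective label := by
    intro x x' hxx'
    have h1 := hl x x'.1
    have h2 := hl x' x.1
    rw [← hxx'] at h2
    have h3 : Function.update (seq x x') r t ∈ φ (labelledAt q r (label x)) := by
      refine mem_map_of_swap φ (X := labelledAt p r (label x)) (i := p) (j := q) ?_ ?_
      · rintro c s ⟨t, ht, ha⟩
        exact ⟨t, by simpa [Equiv.swap_apply_of_ne_of_ne hpr.symm hqr.symm] using ht,
          by simpa using ha⟩
      · convert h2 using 1
        rw [← hseq_swap]
        funext l
        by_cases hr : l = r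
        · subst hr; simp [Equiv.swap_apply_of_ne_of_ne hpr.symm hqr.symm]
        · have : Equiv.swap p q l ≠ r := fun e => hr (by
            rw [← Equiv.swap_apply_of_ne_of_ne hpr.symm hqr.symm] at e
            exact (Equiv.swap p q).injective e)
          simp [hr, this]
    have h4 : Function.update (seq x x') r t ∈ φ (ofInvariant {s | s p = s q}
        fun g s hs => congrArg (g • ·) hs) := by
      refine map_inter φ ?_ h1 h3
      rintro c s ⟨t, ht, ha⟩ ⟨t', ht', ha'⟩
      rw [ht] at ht'
      cases ht'
      exact ha.trans ha'.symm
    have := eq_of_mem_map φ (X := ofInvariant {s | s p = s q} fun g s hs => congrArg (g • ·) hs)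
      (i := p) (j := q) (fun c s hs => hs) h4
    exact Subtype.ext (by simpa [seq, hpr, hqr, hpq] using this)
  have : Finite N := Finite.of_injective label hlinj
  have := Fintype.ofFinite N
  have : Nonempty N := ⟨⟨w p, 0, w q, by simpa [E, hseq] using hw⟩⟩
  refine not_symmetric_split (N := N) (C := Colour k) ?_ ?_ (fun c x y => E c x y)
    (fun c x y => hsymm c x y) (fun c x => hirrefl c x) (fun c c' x y => hdisj c c' x y) ?_
  -- There are `2k+1` labels, one more than the number of colours.
  · refine (Fintype.card_le_of_injective label hlinj).trans ?_
    simp [ZMod.card, Fintype.card_prod, mul_comm]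
  · simp [ZMod.card, Fintype.card_prod]
  · rintro c ⟨x, c', y, hxy⟩
    obtain ⟨z, hz⟩ := htotal c' c x y hxy
    exact ⟨⟨z, c, x, hsymm c x z hz⟩, hz⟩

end Hom

end splitAlgebra

theorem splitAlgebra_not_isoToPse (hα : 3 ≤ α) [NeZero k] :
    ¬ IsoToPse.{u, v} α (splitAlgebra.{u} α k) := by
  rintro ⟨W, S, ⟨e⟩⟩
  exact splitAlgebra.not_injective_hom (S.subtype.comp e.toEmbedding).toHom hα
    (S.subtype.comp e.toEmbedding).injective

end NonRepresentability

theorem theorem3 (α n : ℕ) (hα : 3 ≤ α) :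
    ∃ (A : Type u) (_ : (polyadicLanguage α).Structure A),
      ¬ IsoToPse.{u, v} α A ∧
      (∀ S : (polyadicLanguage α).Substructure A, IsNGenerated n S → IsoToPse.{u, v} α S) ∧
      ReductIsoToSubPse.{u, v} α (cylFreeOps α) A ∧
      ReductIsoToSubPse.{u, v} α (diagFreeOps α) A ∧
      ReductIsoToSubPse.{u, v} α (transpFreeOps α) A :=
  have : NeZero (2 ^ (α * α * n)) := ⟨by positivity⟩
  ⟨splitAlgebra.{u} α (2 ^ (α * α * n)), inferInstance, splitAlgebra_not_isoToPse hα,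
    splitAlgebra_isoToPse_of_isNGenerated hα le_rfl, splitAlgebra_cylFree hα,
    splitAlgebra_diagFree hα, splitAlgebra_transpFree hα⟩
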